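/- Let $J_\nu$, $Y_\nu$ be the Bessel functions of the first and second kind of real order $\nu$, and let $r_0>0$. Let $L_2(r_0,\infty;r)$ be the space of (classes of) measurable real functions on $(r_0,\infty)$ with $\int_{r_0}^\infty |f(r)|^2\,r\,dr<\infty$. For $k,l\in\mathbb{R}$ and $\lambda>0$ put $$W_{k,l}[f](\lambda)=\int_{r_0}^\infty \frac{J_k(\lambda s)Y_l(\lambda r_0)-Y_k(\lambda s)J_l(\lambda r_0)}{\sqrt{J_l^2(\lambda r_0)+Y_l^2(\lambda r_0)}}\,f(s)\,s\,ds ,$$ where the integral is understood as $\lim_{R\to\infty}\int_{r_0}^R$, and let $\ker(W_{k,l})$ be the linear subspace of all $f\in L_2(r_0,\infty;r)$ such that for every $\lambda>0$ this integral converges and $W_{k,l}[f](\lambda)=0$. 1. For every real $k>1$ the function $r^{-k}$ lies in $L_2(r_0,\infty;r)$ and belongs to $\ker(W_{k,k-1})$; in particular $\ker(W_{k,k-1})\neq\{0\}$. 2. For every real $k<-1$ the function $r^{k}$ lies in $L_2(r_0,\infty;r)$ and belongs to $\ker(W_{k,k+1})$; in particular $\ker(W_{k,k+1})\neq\{0\}$.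 -/

import Mathlib

open MeasureTheory Filter Topology

/-- The Bessel function of the first kind `J_ν(x)` of real order `ν`, for `x > 0`:
`J_ν(x) = ∑ₘ (-1)ᵐ / (m! Γ(m + ν + 1)) (x / 2)^(2m + ν)`.
As `Real.Gamma` vanishes at the non-positive integers, the terms in which `Γ` has a pole are `0`,
which is the usual convention `1 / Γ(-n) = 0`. -/
noncomputable def besselJ (ν x : ℝ) : ℝ :=
  ∑' m : ℕ, (-1 : ℝ) ^ m / ((m.factorial : ℝ) * Real.Gamma (m + ν + 1)) *
    (x / 2) ^ (2 * (m : ℝ) + ν)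

/-- The quotient `(J_ν(x) cos(νπ) - J_{-ν}(x)) / sin(νπ)`, meaningful for `ν` not an integer. -/
noncomputable def besselYQuot (ν x : ℝ) : ℝ :=
  (besselJ ν x * Real.cos (ν * Real.pi) - besselJ (-ν) x) / Real.sin (ν * Real.pi)

open Classical in
/-- The Bessel function of the second kind `Y_ν(x)` of real order `ν`, for `x > 0`: the quotient
`(J_ν(x) cos(νπ) - J_{-ν}(x)) / sin(νπ)` if `ν` is not an integer, and the limit of these quotients
as the order tends to `ν` if it is. -/
noncomputable def besselY (ν x : ℝ) : ℝ :=
  if ∃ n : ℤ, ν = n then limUnder (𝓝[≠] ν) (fun μ : ℝ => besselYQuot μ x)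
  else besselYQuot ν x

/-- The kernel of the Weber-Orr transform `W_{k,l}`:
`(J_k(λs) Y_l(λr₀) - Y_k(λs) J_l(λr₀)) / √(J_l(λr₀)² + Y_l(λr₀)²)`. -/
noncomputable def weberOrrKernel (k l r₀ lam s : ℝ) : ℝ :=
  (besselJ k (lam * s) * besselY l (lam * r₀) - besselY k (lam * s) * besselJ l (lam * r₀)) /
    Real.sqrt (besselJ l (lam * r₀) ^ 2 + besselY l (lam * r₀) ^ 2)

/-- The integral `W_{k,l}[f](λ) = ∫_{r₀}^∞ weberOrrKernel k l r₀ λ s * f(s) s ds` converges, as the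
limit of the Lebesgue integrals over `(r₀, R)` for `R → ∞`, and has the value `w`. -/
def HasWeberOrr (k l r₀ : ℝ) (f : ℝ → ℝ) (lam w : ℝ) : Prop :=
  (∀ R : ℝ, r₀ ≤ R →
    IntervalIntegrable (fun s => weberOrrKernel k l r₀ lam s * f s * s) volume r₀ R) ∧
  Tendsto (fun R : ℝ => ∫ s in r₀..R, weberOrrKernel k l r₀ lam s * f s * s) atTop (𝓝 w)

/-- The measure `r dr` on `(r₀, ∞)`, so that `L₂(r₀, ∞; r)` is `Lp ℝ 2 (radialMeasure r₀)`. -/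
noncomputable def radialMeasure (r₀ : ℝ) : Measure ℝ :=
  (volume.restrict (Set.Ioi r₀)).withDensity (fun r => ENNReal.ofReal r)

theorem ae_restrict_of_ae_radialMeasure {r₀ : ℝ} (hr₀ : 0 < r₀) {p : ℝ → Prop}
    (h : ∀ᵐ s ∂(radialMeasure r₀), p s) : ∀ᵐ s ∂(volume.restrict (Set.Ioi r₀)), p s := by
  rw [radialMeasure, ae_withDensity_iff ENNReal.measurable_ofReal] at h
  filter_upwards [h, ae_restrict_mem measurableSet_Ioi] with s hs hmem
  refine hs ?_
  have : 0 < s := hr₀.trans hmem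
  simpa using this

theorem HasWeberOrr.congr_ae {k l r₀ lam w : ℝ} (hr₀ : 0 < r₀) {f g : ℝ → ℝ}
    (hf : HasWeberOrr k l r₀ f lam w) (h : f =ᵐ[radialMeasure r₀] g) :
    HasWeberOrr k l r₀ g lam w := by
  have h1 : ∀ R, r₀ ≤ R → (fun s => weberOrrKernel k l r₀ lam s * f s * s)
      =ᵐ[volume.restrict (Set.uIoc r₀ R)] fun s => weberOrrKernel k l r₀ lam s * g s * s := by
    intro R hR
    have hsub : Set.uIoc r₀ R ⊆ Set.Ioi r₀ := by
      rw [Set.uIoc_of_le hR]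
      exact Set.Ioc_subset_Ioi_self
    filter_upwards [ae_restrict_of_ae_restrict_of_subset hsub
      (ae_restrict_of_ae_radialMeasure hr₀ h)] with s hs
    rw [hs]
  refine ⟨fun R hR => (hf.1 R hR).congr_ae (h1 R hR), hf.2.congr' ?_⟩
  filter_upwards [eventually_ge_atTop r₀] with R hR
  exact intervalIntegral.integral_congr_ae_restrict (h1 R hR)

theorem HasWeberOrr.add {k l r₀ lam v w : ℝ} {f g : ℝ → ℝ}
    (hf : HasWeberOrr k l r₀ f lam v) (hg : HasWeberOrr k l r₀ g lam w) :
    HasWeberOrr k l r₀ (f + g) lam (v + w) := by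
  have e : (fun s => weberOrrKernel k l r₀ lam s * (f + g) s * s) =
      fun s => weberOrrKernel k l r₀ lam s * f s * s + weberOrrKernel k l r₀ lam s * g s * s := by
    funext s
    simp only [Pi.add_apply]
    ring
  rw [HasWeberOrr, e]
  refine ⟨fun R hR => (hf.1 R hR).add (hg.1 R hR), (hf.2.add hg.2).congr' ?_⟩
  filter_upwards [eventually_ge_atTop r₀] with R hR
  exact (intervalIntegral.integral_add (hf.1 R hR) (hg.1 R hR)).symm

theorem HasWeberOrr.const_smul {k l r₀ lam w : ℝ} {f : ℝ → ℝ} (c : ℝ)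
    (hf : HasWeberOrr k l r₀ f lam w) : HasWeberOrr k l r₀ (c • f) lam (c * w) := by
  have e : (fun s => weberOrrKernel k l r₀ lam s * (c • f) s * s) =
      fun s => c * (weberOrrKernel k l r₀ lam s * f s * s) := by
    funext s
    simp only [Pi.smul_apply, smul_eq_mul]
    ring
  rw [HasWeberOrr, e]
  refine ⟨fun R hR => (hf.1 R hR).const_mul c, ?_⟩
  simp only [intervalIntegral.integral_const_mul]
  exact hf.2.const_mul c

theorem HasWeberOrr.zero (k l r₀ lam : ℝ) : HasWeberOrr k l r₀ 0 lam 0 := by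
  simp [HasWeberOrr]

/-- The kernel `ker(W_{k,l}) ⊆ L₂(r₀, ∞; r)`: all `f` whose transform `W_{k,l}[f]` exists and
vanishes at every `λ > 0`. -/
noncomputable def weberOrrKer (k l r₀ : ℝ) (hr₀ : 0 < r₀) :
    Submodule ℝ (Lp ℝ 2 (radialMeasure r₀)) where
  carrier := {f | ∀ lam : ℝ, 0 < lam → HasWeberOrr k l r₀ f lam 0}
  zero_mem' := fun lam _ =>
    (HasWeberOrr.zero k l r₀ lam).congr_ae hr₀ (Lp.coeFn_zero ℝ 2 (radialMeasure r₀)).symm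
  add_mem' := fun {f g} hf hg lam hlam => by
    have h := (hf lam hlam).add (hg lam hlam)
    rw [add_zero] at h
    exact h.congr_ae hr₀ (Lp.coeFn_add f g).symm
  smul_mem' := fun c f hf lam hlam => by
    have h := (hf lam hlam).const_smul c
    rw [mul_zero] at h
    exact h.congr_ae hr₀ (Lp.coeFn_smul c f).symm

/-! The integrand has an explicit antiderivative. For a cylinder function `C`, a fixed combination
of `J` and `Y`, one has `(s^(-ν) C_ν(λs))' = -λ s^(-ν) C_{ν+1}(λs)` and `(s^(ν+1) C_{ν+1}(λs))' = λ
s^(ν+1) C_ν(λs)`. With `ν = k - 1` in the first and `ν = k` in the second, the right-hand sides are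
the integrands for `r^(-k)` and `r^k` up to a constant. The antiderivative is a power of `s` times
`C_l(λs)`, with `C_l(λr₀) = 0` by the choice of combination. It tends to `0` at infinity because the
power is negative and `C_l` is bounded there (`IsCylinderPair.exists_bound`).

Most of the work is to obtain the two differential relations for every real order
(`isCylinderPair_besselJ`, `isCylinderPair_besselY`). For `J` they follow from the power series and
`1/Γ(z) = z/Γ(z+1)`. For `Y` of integer order, the limit is evaluated through derivatives of `J` in
the order. -/

/-! ### The reciprocal Gamma function. -/

/-- The reciprocal of the real Gamma function, an entire function. -/
noncomputable def invGamma (x : ℝ) : ℝ := (Real.Gamma x)⁻¹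

theorem contDiff_invGamma : ContDiff ℝ 1 invGamma := by
  have h : ContDiff ℂ 1 (fun s : ℂ => (Complex.Gamma s)⁻¹) :=
    Complex.differentiable_one_div_Gamma.contDiff
  have h2 := h.real_of_complex
  have e : (fun x : ℝ => ((Complex.Gamma (x : ℂ))⁻¹).re) = invGamma := by
    funext x
    rw [Complex.Gamma_ofReal, ← Complex.ofReal_inv, Complex.ofReal_re, invGamma]
  rwa [e] at h2

theorem invGamma_eq_mul (x : ℝ) : invGamma x = x * invGamma (x + 1) := by
  rcases eq_or_ne x 0 with rfl | hx
  -- At the pole `Real.Gamma 0 = 0`, so both sides vanish.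
  · simp [invGamma]
  · rw [invGamma, invGamma, Real.Gamma_add_one hx]
    field_simp

theorem hasDerivAt_invGamma (x : ℝ) : HasDerivAt invGamma (deriv invGamma x) x :=
  ((contDiff_invGamma.differentiable one_ne_zero) x).hasDerivAt

theorem deriv_invGamma_eq (x : ℝ) :
    deriv invGamma x = invGamma (x + 1) + x * deriv invGamma (x + 1) := by
  have h1 : HasDerivAt (fun y : ℝ => y * invGamma (y + 1))
      (1 * invGamma (x + 1) + x * deriv invGamma (x + 1)) x :=
    (hasDerivAt_id x).mul ((hasDerivAt_invGamma (x + 1)).comp_add_const x 1)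
  have e : (fun y : ℝ => y * invGamma (y + 1)) = invGamma := by
    funext y
    exact (invGamma_eq_mul y).symm
  rw [e] at h1
  rw [h1.deriv, one_mul]

/-- A bound on a compact interval propagates to the right by unit steps: with `g = 1/Γ`, `(x-1) g(x)
= g(x-1)` and `(x-1) g'(x) = g'(x-1) - g(x)`. The last right-hand side is at most `2M`, and `x - 1 ≥
2` absorbs the factor. -/
theorem exists_bound_invGamma (a : ℝ) :
    ∃ M : ℝ, ∀ x, a ≤ x → |invGamma x| ≤ M ∧ |deriv invGamma x| ≤ M := by
  have hc : Continuous fun x => |invGamma x| + |deriv invGamma x| :=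
    contDiff_invGamma.continuous.abs.add (contDiff_invGamma.continuous_deriv le_rfl).abs
  obtain ⟨M, hM⟩ := (isCompact_Icc (a := min a 2) (b := 3)).bddAbove_image hc.continuousOn
  have h0 : ∀ x, min a 2 ≤ x → x ≤ 3 → |invGamma x| ≤ M ∧ |deriv invGamma x| ≤ M := by
    intro x h1 h2
    have := hM (Set.mem_image_of_mem _ (Set.mem_Icc.2 ⟨h1, h2⟩))
    have h3 := abs_nonneg (invGamma x)
    have h4 := abs_nonneg (deriv invGamma x)
    constructor <;> linarith
  have key : ∀ n : ℕ, ∀ x, min a 2 ≤ x → x ≤ 3 + n →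
      |invGamma x| ≤ M ∧ |deriv invGamma x| ≤ M := by
    intro n
    induction n with
    | zero => simpa using h0
    | succ n ih =>
      intro x h1 h2
      push_cast at h2
      rcases le_or_gt x (3 + n) with h | h
      · exact ih x h1 h
      have hn : (0 : ℝ) ≤ n := n.cast_nonneg
      have hx : 2 ≤ x - 1 := by linarith
      obtain ⟨i1, i2⟩ := ih (x - 1) ((min_le_right a 2).trans hx) (by linarith)
      have e1 := invGamma_eq_mul (x - 1)
      have e2 := deriv_invGamma_eq (x - 1)
      rw [sub_add_cancel] at e1 e2
      have hM0 : 0 ≤ M := (abs_nonneg _).trans i1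
      have b1 : |invGamma x| ≤ M := by
        rw [e1, abs_mul, abs_of_pos (by linarith : 0 < x - 1)] at i1
        nlinarith [abs_nonneg (invGamma x)]
      refine ⟨b1, ?_⟩
      have e3 : (x - 1) * deriv invGamma x = deriv invGamma (x - 1) - invGamma x := by linarith
      have b2 : (x - 1) * |deriv invGamma x| ≤ M + M := by
        rw [← abs_of_pos (by linarith : 0 < x - 1), ← abs_mul, e3]
        exact (abs_sub _ _).trans (add_le_add i2 b1)
      nlinarith [abs_nonneg (deriv invGamma x)]
  refine ⟨M, fun x hx => ?_⟩
  obtain ⟨n, hn⟩ := exists_nat_ge (x - 3)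
  exact key n x ((min_le_left a 2).trans hx) (by linarith)

/-! ### Power series: differentiation in the argument and in the order. -/

/-- The alternating exponential generating function `∑ₘ (-t)ᵐ / m! * c m` of a sequence. -/
noncomputable def altExpSeries (c : ℕ → ℝ) (t : ℝ) : ℝ :=
  ∑' m : ℕ, (-t) ^ m / (m.factorial : ℝ) * c m

theorem norm_altExpSeries_term_le {c : ℕ → ℝ} {M : ℝ} (hc : ∀ m, |c m| ≤ M) {t T : ℝ}
    (ht : |t| ≤ T) (m : ℕ) :
    ‖(-t) ^ m / (m.factorial : ℝ) * c m‖ ≤ T ^ m / (m.factorial : ℝ) * M := by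
  have hT : 0 ≤ T := (abs_nonneg t).trans ht
  rw [Real.norm_eq_abs, abs_mul, abs_div, abs_pow, abs_neg, Nat.abs_cast]
  exact mul_le_mul (by gcongr) (hc m) (abs_nonneg _) (by positivity)

theorem summable_altExpSeries {c : ℕ → ℝ} {M : ℝ} (hc : ∀ m, |c m| ≤ M) (t : ℝ) :
    Summable fun m : ℕ => (-t) ^ m / (m.factorial : ℝ) * c m :=
  .of_norm_bounded ((Real.summable_pow_div_factorial |t|).mul_right M)
    (norm_altExpSeries_term_le hc le_rfl)

theorem hasDerivAt_altExpSeries {c : ℕ → ℝ} {M : ℝ} (hc : ∀ m, |c m| ≤ M) (t : ℝ) :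
    HasDerivAt (altExpSeries c) (-altExpSeries (fun m => c (m + 1)) t) t := by
  have hshift : ∀ (y : ℝ) (m : ℕ), -((((m + 1 : ℕ) : ℝ) * (-y) ^ m) / ((m + 1).factorial : ℝ)
      * c (m + 1)) = -((-y) ^ m / (m.factorial : ℝ) * c (m + 1)) := by
    intro y m
    rw [Nat.factorial_succ]
    push_cast
    field_simp
  have hT : |t| < |t| + 1 := by linarith
  have hu : Summable fun m : ℕ => ((m : ℝ) * (|t| + 1) ^ (m - 1)) / (m.factorial : ℝ) * M := by
    refine Summable.mul_right M ((summable_nat_add_iff 1).1 ?_)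
    refine (Real.summable_pow_div_factorial (|t| + 1)).congr fun m => ?_
    rw [Nat.factorial_succ, Nat.add_sub_cancel]
    push_cast
    field_simp
  -- Termwise differentiation, dominated on the ball of radius `|t| + 1`.
  have h := hasDerivAt_tsum_of_isPreconnected (𝕜 := ℝ) (F := ℝ)
    (g := fun (m : ℕ) y => (-y) ^ m / (m.factorial : ℝ) * c m)
    (g' := fun (m : ℕ) y => -((m : ℝ) * (-y) ^ (m - 1) / (m.factorial : ℝ) * c m))
    (u := fun m : ℕ => ((m : ℝ) * (|t| + 1) ^ (m - 1)) / (m.factorial : ℝ) * M)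
    (t := Metric.ball 0 (|t| + 1)) (y₀ := t) (y := t) hu Metric.isOpen_ball
    (convex_ball 0 _).isPreconnected ?_ ?_ (by simp) (summable_altExpSeries hc t) (by simp)
  · have e : ∑' m : ℕ, -((m : ℝ) * (-t) ^ (m - 1) / (m.factorial : ℝ) * c m) =
        -altExpSeries (fun m => c (m + 1)) t := by
      have hs : Summable fun m : ℕ => -((m : ℝ) * (-t) ^ (m - 1) / (m.factorial : ℝ) * c m) := by
        refine (summable_nat_add_iff 1).1 ?_
        refine (summable_altExpSeries (fun m => hc (m + 1)) t).neg.congr fun m => ?_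
        rw [Nat.add_sub_cancel, hshift]
      rw [hs.tsum_eq_zero_add, altExpSeries, ← tsum_neg]
      simp only [Nat.add_sub_cancel, hshift]
      simp
    rw [e] at h
    exact h
  · intro m y _
    have h1 := (((hasDerivAt_id y).neg.pow m).div_const (m.factorial : ℝ)).mul_const (c m)
    refine h1.congr_deriv ?_
    simp only [Pi.neg_apply, id]
    ring
  · intro m y hy
    have hy' : |y| ≤ |t| + 1 := by simpa using (mem_ball_zero_iff.1 hy).le
    rw [norm_neg, Real.norm_eq_abs, abs_mul, abs_div, abs_mul, abs_pow, abs_neg, Nat.abs_cast,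
      Nat.abs_cast]
    exact mul_le_mul (by gcongr) (hc m) (abs_nonneg _) (by positivity)

/-- The series `∑ₘ (-t)ᵐ / (m! Γ(m + ν + 1))`. -/
noncomputable def besselSeries (ν t : ℝ) : ℝ := altExpSeries (fun m => invGamma (m + ν + 1)) t

/-- The derivative of `besselSeries` in the order. -/
noncomputable def besselSeriesDeriv (ν t : ℝ) : ℝ :=
  altExpSeries (fun m => deriv invGamma (m + ν + 1)) t

theorem exists_bound_invGamma_nat_add (a : ℝ) : ∃ M : ℝ, ∀ ν, a ≤ ν → ∀ m : ℕ,
    |invGamma (m + ν + 1)| ≤ M ∧ |deriv invGamma (m + ν + 1)| ≤ M := by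
  obtain ⟨M, hM⟩ := exists_bound_invGamma a
  exact ⟨M, fun ν hν m => hM _ (by linarith [m.cast_nonneg (α := ℝ)])⟩

theorem hasDerivAt_besselSeries (ν t : ℝ) :
    HasDerivAt (besselSeries ν) (-besselSeries (ν + 1) t) t := by
  obtain ⟨M, hM⟩ := exists_bound_invGamma_nat_add ν
  have h := hasDerivAt_altExpSeries (fun m => (hM ν le_rfl m).1) t
  have e : (fun m : ℕ => invGamma ((m + 1 : ℕ) + ν + 1)) =
      fun m : ℕ => invGamma (m + (ν + 1) + 1) := by
    funext m
    push_cast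
    ring_nf
  rw [e] at h
  exact h

theorem hasDerivAt_besselSeriesDeriv (ν t : ℝ) :
    HasDerivAt (besselSeriesDeriv ν) (-besselSeriesDeriv (ν + 1) t) t := by
  obtain ⟨M, hM⟩ := exists_bound_invGamma_nat_add ν
  have h := hasDerivAt_altExpSeries (fun m => (hM ν le_rfl m).2) t
  have e : (fun m : ℕ => deriv invGamma ((m + 1 : ℕ) + ν + 1)) =
      fun m : ℕ => deriv invGamma (m + (ν + 1) + 1) := by
    funext m
    push_cast
    ring_nf
  rw [e] at h
  exact h

theorem hasDerivAt_besselSeries_order (ν t : ℝ) :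
    HasDerivAt (fun μ => besselSeries μ t) (besselSeriesDeriv ν t) ν := by
  obtain ⟨M, hM⟩ := exists_bound_invGamma_nat_add (ν - 1)
  refine hasDerivAt_tsum_of_isPreconnected (𝕜 := ℝ) (F := ℝ)
    (g := fun (m : ℕ) μ => (-t) ^ m / (m.factorial : ℝ) * invGamma (m + μ + 1))
    (g' := fun (m : ℕ) μ => (-t) ^ m / (m.factorial : ℝ) * deriv invGamma (m + μ + 1))
    (u := fun m : ℕ => |t| ^ m / (m.factorial : ℝ) * M)
    (t := Set.Ioi (ν - 1)) (y₀ := ν) (y := ν)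
    ((Real.summable_pow_div_factorial |t|).mul_right M) isOpen_Ioi isPreconnected_Ioi
    ?_ ?_ (by simp) (summable_altExpSeries (fun m => (hM ν (by linarith) m).1) t) (by simp)
  · intro m y _
    have h := (hasDerivAt_invGamma (m + y + 1)).comp y
      (((hasDerivAt_id y).const_add (m : ℝ)).add_const 1)
    rw [mul_one] at h
    exact h.const_mul _
  · intro m y hy
    exact norm_altExpSeries_term_le (c := fun m => deriv invGamma (m + y + 1))
      (fun m => (hM y (le_of_lt hy) m).2) le_rfl m

/-- Since `1/Γ(m+ν) - ν/Γ(m+ν+1) = m/Γ(m+ν+1)`, the term `m = 0` of the difference drops out and the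
factor `m` shifts the factorial. -/
theorem besselSeries_recurrence (ν t : ℝ) :
    besselSeries (ν - 1) t = ν * besselSeries ν t - t * besselSeries (ν + 1) t := by
  obtain ⟨M, hM⟩ := exists_bound_invGamma_nat_add (ν - 1)
  have h1 := summable_altExpSeries (fun m => (hM ν (by linarith) m).1) t
  have h2 := summable_altExpSeries (fun m => (hM (ν - 1) le_rfl m).1) t
  have h3 := summable_altExpSeries (fun m => (hM (ν + 1) (by linarith) m).1) t
  have h4 := h2.sub (h1.mul_left ν)
  have e : besselSeries (ν - 1) t - ν * besselSeries ν t = -t * besselSeries (ν + 1) t := by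
    simp only [besselSeries, altExpSeries]
    rw [← tsum_mul_left, ← h2.tsum_sub (h1.mul_left ν), h4.tsum_eq_zero_add, ← tsum_mul_left]
    have e0 := invGamma_eq_mul ν
    simp only [Nat.cast_zero, pow_zero, Nat.factorial_zero, Nat.cast_one]
    rw [show (0 : ℝ) + (ν - 1) + 1 = ν by ring, show (0 : ℝ) + ν + 1 = ν + 1 by ring, e0]
    rw [show (1 : ℝ) / 1 * (ν * invGamma (ν + 1)) - ν * (1 / 1 * invGamma (ν + 1)) = 0 by ring,
      zero_add]
    congr 1
    funext m
    have e1 := invGamma_eq_mul (m + ν + 1)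
    rw [Nat.factorial_succ]
    push_cast
    rw [show (m : ℝ) + 1 + (ν - 1) + 1 = m + ν + 1 by ring, e1,
      show (m : ℝ) + 1 + ν + 1 = m + ν + 1 + 1 by ring,
      show (m : ℝ) + (ν + 1) + 1 = m + ν + 1 + 1 by ring, pow_succ]
    field_simp
    ring
  linarith

/-! ### `J` and its derivative in the order. -/

theorem besselJ_eq (ν : ℝ) {x : ℝ} (hx : 0 < x) :
    besselJ ν x = (x / 2) ^ ν * besselSeries ν (x ^ 2 / 4) := by
  have hx2 : 0 < x / 2 := by positivity
  rw [besselJ, besselSeries, altExpSeries, ← tsum_mul_left]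
  congr 1
  funext m
  rw [Real.rpow_add hx2, show (2 : ℝ) * m = ((2 * m : ℕ) : ℝ) by push_cast; ring,
    Real.rpow_natCast, pow_mul, show (x / 2) ^ 2 = x ^ 2 / 4 by ring, invGamma,
    neg_pow (x ^ 2 / 4)]
  field_simp

/-- The derivative of `besselJ ν x` in the order `ν`, for `x > 0`. -/
noncomputable def besselJOrderDeriv (ν x : ℝ) : ℝ :=
  Real.log (x / 2) * besselJ ν x + (x / 2) ^ ν * besselSeriesDeriv ν (x ^ 2 / 4)

theorem hasDerivAt_besselJ_order (ν : ℝ) {x : ℝ} (hx : 0 < x) :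
    HasDerivAt (fun μ => besselJ μ x) (besselJOrderDeriv ν x) ν := by
  have hx2 : 0 < x / 2 := by positivity
  have e : (fun μ => besselJ μ x) = fun μ => (x / 2) ^ μ * besselSeries μ (x ^ 2 / 4) := by
    funext μ
    exact besselJ_eq μ hx
  rw [e]
  refine (((hasDerivAt_id ν).const_rpow hx2).mul
    (hasDerivAt_besselSeries_order ν (x ^ 2 / 4))).congr_deriv ?_
  rw [besselJOrderDeriv, besselJ_eq ν hx]
  simp only [id]
  ring

theorem hasDerivAt_sq_div_four (x : ℝ) : HasDerivAt (fun y : ℝ => y ^ 2 / 4) (x / 2) x := by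
  refine (((hasDerivAt_id x).pow 2).div_const 4).congr_deriv ?_
  simp only [id]
  ring

theorem hasDerivAt_half_rpow_mul (ν : ℝ) {x : ℝ} (hx : 0 < x) {f : ℝ → ℝ} {f' : ℝ}
    (hf : HasDerivAt f (-f') (x ^ 2 / 4)) :
    HasDerivAt (fun y => (y / 2) ^ ν * f (y ^ 2 / 4))
      (ν / x * ((x / 2) ^ ν * f (x ^ 2 / 4)) - (x / 2) ^ (ν + 1) * f') x := by
  have hx2 : 0 < x / 2 := by positivity
  have h1 := ((hasDerivAt_id x).div_const 2).rpow_const (p := ν) (Or.inl hx2.ne')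
  refine (h1.mul (hf.comp x (hasDerivAt_sq_div_four x))).congr_deriv ?_
  simp only [id, Function.comp]
  rw [Real.rpow_sub_one hx2.ne', Real.rpow_add_one hx2.ne']
  field_simp
  ring

theorem hasDerivAt_besselJ (ν : ℝ) {x : ℝ} (hx : 0 < x) :
    HasDerivAt (besselJ ν) (ν / x * besselJ ν x - besselJ (ν + 1) x) x := by
  have h := hasDerivAt_half_rpow_mul ν hx (hasDerivAt_besselSeries ν (x ^ 2 / 4))
  rw [← besselJ_eq ν hx, ← besselJ_eq (ν + 1) hx] at h
  refine h.congr_of_eventuallyEq ?_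
  filter_upwards [lt_mem_nhds hx] with y hy
  exact besselJ_eq ν hy

theorem besselJ_recurrence (ν : ℝ) {x : ℝ} (hx : 0 < x) :
    besselJ (ν - 1) x = 2 * ν / x * besselJ ν x - besselJ (ν + 1) x := by
  have hx2 : 0 < x / 2 := by positivity
  rw [besselJ_eq _ hx, besselJ_eq _ hx, besselJ_eq _ hx, besselSeries_recurrence,
    Real.rpow_sub_one hx2.ne', Real.rpow_add_one hx2.ne']
  field_simp
  ring

theorem hasDerivAt_besselJOrderDeriv (ν : ℝ) {x : ℝ} (hx : 0 < x) :
    HasDerivAt (besselJOrderDeriv ν) (besselJ ν x / x + ν / x * besselJOrderDeriv ν x -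
      besselJOrderDeriv (ν + 1) x) x := by
  have hx2 : 0 < x / 2 := by positivity
  have h := hasDerivAt_half_rpow_mul ν hx (hasDerivAt_besselSeriesDeriv ν (x ^ 2 / 4))
  have hl := ((hasDerivAt_id x).div_const 2).log hx2.ne'
  refine ((hl.mul (hasDerivAt_besselJ ν hx)).add h).congr_deriv ?_
  simp only [id, besselJOrderDeriv]
  field_simp
  ring

/-- The recurrence for `J` holds identically in the order, so it may be differentiated there. -/
theorem besselJOrderDeriv_recurrence (ν : ℝ) {x : ℝ} (hx : 0 < x) :
    besselJOrderDeriv (ν - 1) x = 2 / x * besselJ ν x + 2 * ν / x * besselJOrderDeriv ν x -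
      besselJOrderDeriv (ν + 1) x := by
  have h1 := (hasDerivAt_besselJ_order (ν - 1) hx).comp_sub_const ν 1
  have h2 := ((((hasDerivAt_id ν).const_mul 2).div_const x).mul
    (hasDerivAt_besselJ_order ν hx)).sub ((hasDerivAt_besselJ_order (ν + 1) hx).comp_add_const ν 1)
  have e : (fun μ => besselJ (μ - 1) x) =
      fun μ => 2 * μ / x * besselJ μ x - besselJ (μ + 1) x := by
    funext μ
    exact besselJ_recurrence μ hx
  rw [e] at h1
  rw [h1.unique h2]
  simp only [id]
  ring

/-! ### Integer orders and `Y`. -/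

theorem besselJ_neg_nat (n : ℕ) {x : ℝ} (hx : 0 < x) :
    besselJ (-(n : ℝ)) x = (-1) ^ n * besselJ n x := by
  induction n using Nat.twoStepInduction with
  | zero => simp
  | one =>
    have h := besselJ_recurrence 0 hx
    norm_num at h
    simp [h]
  | more n h0 h1 =>
    have r1 := besselJ_recurrence (-(n + 1 : ℝ)) hx
    have r2 := besselJ_recurrence (n + 1 : ℝ) hx
    push_cast at h1 ⊢
    rw [show -((n : ℝ) + 1) - 1 = -(n + 2) by ring, show -((n : ℝ) + 1) + 1 = -n by ring, h0, h1]
      at r1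
    rw [show (n : ℝ) + 1 - 1 = n by ring, show (n : ℝ) + 1 + 1 = n + 2 by ring] at r2
    rw [r1, r2]
    ring

theorem besselJ_neg_int (n : ℤ) {x : ℝ} (hx : 0 < x) :
    besselJ (-(n : ℝ)) x = Real.cos (n * Real.pi) * besselJ n x := by
  obtain ⟨m, rfl | rfl⟩ := n.eq_nat_or_neg
  · have := besselJ_neg_nat m hx
    rw [Real.cos_int_mul_pi]
    simpa using this
  · have := besselJ_neg_nat m hx
    rw [Real.cos_int_mul_pi]
    push_cast
    rw [neg_neg, this, ← mul_assoc, zpow_neg, zpow_natCast, inv_mul_cancel₀ (by simp), one_mul]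

theorem besselY_of_not_int {ν : ℝ} (h : ¬∃ n : ℤ, ν = n) (x : ℝ) :
    besselY ν x = (besselJ ν x * Real.cos (ν * Real.pi) - besselJ (-ν) x) /
      Real.sin (ν * Real.pi) := by
  rw [besselY, if_neg h, besselYQuot]

/-- L'Hôpital in the order: numerator and denominator both vanish at `n`, so the quotient is a
quotient of slopes. -/
theorem tendsto_besselYQuot (n : ℤ) {x : ℝ} (hx : 0 < x) :
    Tendsto (fun μ => besselYQuot μ x) (𝓝[≠] (n : ℝ))
      (𝓝 ((besselJOrderDeriv n x + Real.cos (n * Real.pi) * besselJOrderDeriv (-n) x) /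
        Real.pi)) := by
  have hsin : Real.sin (n * Real.pi) = 0 := Real.sin_int_mul_pi n
  have hcc : Real.cos (n * Real.pi) * Real.cos (n * Real.pi) = 1 := by
    have := Real.cos_sq_add_sin_sq (n * Real.pi)
    rw [hsin] at this
    linarith
  have hc0 : Real.cos (n * Real.pi) ≠ 0 := fun h => by simp [h] at hcc
  have hm : HasDerivAt (fun μ : ℝ => μ * Real.pi) Real.pi (n : ℝ) := by
    simpa using (hasDerivAt_id (n : ℝ)).mul_const Real.pi
  have hneg : HasDerivAt (fun μ => besselJ (-μ) x) (-besselJOrderDeriv (-n) x) (n : ℝ) := by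
    refine ((hasDerivAt_besselJ_order (-n : ℝ) hx).comp (n : ℝ) (hasDerivAt_neg (n : ℝ))).congr_deriv
      ?_
    ring
  have hN := ((hasDerivAt_besselJ_order (n : ℝ) hx).mul hm.cos).sub hneg
  have hD := hm.sin
  rw [hasDerivAt_iff_tendsto_slope] at hN hD
  have h := hN.div hD (mul_ne_zero hc0 Real.pi_ne_zero)
  have hval : (besselJOrderDeriv n x * Real.cos (n * Real.pi) +
      besselJ n x * (-Real.sin (n * Real.pi) * Real.pi) - -besselJOrderDeriv (-n) x) /
      (Real.cos (n * Real.pi) * Real.pi) =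
      (besselJOrderDeriv n x + Real.cos (n * Real.pi) * besselJOrderDeriv (-n) x) /
        Real.pi := by
    rw [hsin, div_eq_div_iff (mul_ne_zero hc0 Real.pi_ne_zero) Real.pi_ne_zero]
    linear_combination (-besselJOrderDeriv (-n) x * Real.pi) * hcc
  rw [hval] at h
  refine h.congr' ?_
  filter_upwards [self_mem_nhdsWithin] with μ hμ
  have hμ' : μ - n ≠ 0 := sub_ne_zero.2 hμ
  simp only [Pi.div_apply, slope_def_field, Pi.sub_apply, Pi.mul_apply]
  rw [hsin, besselJ_neg_int n hx, besselYQuot, div_div_div_cancel_right₀ hμ']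
  congr 1
  · ring
  · ring

theorem besselY_int (n : ℤ) {x : ℝ} (hx : 0 < x) :
    besselY n x = (besselJOrderDeriv n x + Real.cos (n * Real.pi) * besselJOrderDeriv (-n) x) /
      Real.pi := by
  rw [besselY, if_pos ⟨n, rfl⟩]
  exact (tendsto_besselYQuot n hx).limUnder_eq

theorem not_int_add_one {ν : ℝ} (h : ¬∃ n : ℤ, ν = n) : ¬∃ n : ℤ, ν + 1 = n := by
  rintro ⟨n, hn⟩
  exact h ⟨n - 1, by push_cast; linarith⟩

theorem cos_add_one_mul_pi (ν : ℝ) :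
    Real.cos ((ν + 1) * Real.pi) = -Real.cos (ν * Real.pi) := by
  rw [add_mul, one_mul, Real.cos_add_pi]

theorem sin_add_one_mul_pi (ν : ℝ) :
    Real.sin ((ν + 1) * Real.pi) = -Real.sin (ν * Real.pi) := by
  rw [add_mul, one_mul, Real.sin_add_pi]

theorem hasDerivAt_besselY (ν : ℝ) {x : ℝ} (hx : 0 < x) :
    HasDerivAt (besselY ν) (ν / x * besselY ν x - besselY (ν + 1) x) x := by
  by_cases h : ∃ n : ℤ, ν = n
  · obtain ⟨n, rfl⟩ := h
    have hd := ((hasDerivAt_besselJOrderDeriv n hx).add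
      ((hasDerivAt_besselJOrderDeriv (-n) hx).const_mul (Real.cos (n * Real.pi)))).div_const Real.pi
    refine (hd.congr_of_eventuallyEq ?_).congr_deriv ?_
    · filter_upwards [lt_mem_nhds hx] with y hy
      exact besselY_int n hy
    -- The inhomogeneous terms in `J_n / x` cancel because `J_{-n} = cos(nπ) J_n` and `cos(nπ)² =
    -- 1`.
    · have e1 := besselY_int (n + 1) hx
      push_cast at e1
      have hJ := besselJ_neg_int n hx
      have hcc : Real.cos (n * Real.pi) * Real.cos (n * Real.pi) = 1 := by
        have := Real.cos_sq_add_sin_sq (n * Real.pi)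
        rw [Real.sin_int_mul_pi] at this
        linarith
      have hr := besselJOrderDeriv_recurrence (-n : ℝ) hx
      rw [e1, besselY_int n hx, cos_add_one_mul_pi, show -((n : ℝ) + 1) = -n - 1 by ring, hr, hJ]
      field_simp
      linear_combination (-besselJ n x) * hcc
  · have hd := (((hasDerivAt_besselJ ν hx).mul_const (Real.cos (ν * Real.pi))).sub
      (hasDerivAt_besselJ (-ν) hx)).div_const (Real.sin (ν * Real.pi))
    have e : besselY ν = fun x => (besselJ ν x * Real.cos (ν * Real.pi) - besselJ (-ν) x) /
        Real.sin (ν * Real.pi) := funext (besselY_of_not_int h)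
    rw [besselY_of_not_int (not_int_add_one h), e]
    refine hd.congr_deriv ?_
    have hr := besselJ_recurrence (-ν) hx
    rw [cos_add_one_mul_pi, sin_add_one_mul_pi, show -(ν + 1) = -ν - 1 by ring, hr, div_neg,
      sub_neg_eq_add, ← mul_div_assoc, ← add_div]
    congr 1
    field_simp
    ring

theorem besselY_recurrence (ν : ℝ) {x : ℝ} (hx : 0 < x) :
    besselY ν x = 2 * (ν + 1) / x * besselY (ν + 1) x - besselY (ν + 2) x := by
  by_cases h : ∃ n : ℤ, ν = n
  · obtain ⟨n, rfl⟩ := h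
    have e1 := besselY_int (n + 1) hx
    push_cast at e1
    have e2 := besselY_int (n + 2) hx
    push_cast at e2
    have hJ := besselJ_neg_int (n + 1) hx
    push_cast at hJ
    have hcc : Real.cos (n * Real.pi) * Real.cos (n * Real.pi) = 1 := by
      have := Real.cos_sq_add_sin_sq (n * Real.pi)
      rw [Real.sin_int_mul_pi] at this
      linarith
    have r1 := besselJOrderDeriv_recurrence (n + 1 : ℝ) hx
    have r2 := besselJOrderDeriv_recurrence (-(n + 1) : ℝ) hx
    rw [show (n : ℝ) + 1 - 1 = n by ring, show (n : ℝ) + 1 + 1 = n + 2 by ring] at r1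
    rw [show -((n : ℝ) + 1) - 1 = -(n + 2) by ring, show -((n : ℝ) + 1) + 1 = -n by ring, hJ] at r2
    rw [e1, e2, besselY_int n hx, r1, r2, show (n : ℝ) + 2 = n + 1 + 1 by ring,
      cos_add_one_mul_pi (n + 1), cos_add_one_mul_pi n]
    field_simp
    linear_combination (-2 * besselJ (n + 1) x) * hcc
  · have h1 := not_int_add_one h
    have h2 := not_int_add_one h1
    rw [show ν + 2 = ν + 1 + 1 by ring, besselY_of_not_int h, besselY_of_not_int h1,
      besselY_of_not_int h2, cos_add_one_mul_pi (ν + 1), sin_add_one_mul_pi (ν + 1),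
      cos_add_one_mul_pi, sin_add_one_mul_pi]
    have r1 := besselJ_recurrence (ν + 1) hx
    have r2 := besselJ_recurrence (-(ν + 1)) hx
    rw [show ν + 1 - 1 = ν by ring] at r1
    rw [show -(ν + 1) - 1 = -(ν + 1 + 1) by ring, show -(ν + 1) + 1 = -ν by ring] at r2
    simp only [r1, r2, neg_neg, div_neg]
    rw [mul_neg, ← mul_div_assoc, ← neg_div, ← sub_div]
    congr 1
    ring

/-! ### Cylinder pairs: boundedness and antiderivatives. -/

/-- The first order system satisfied by two cylinder functions of orders `ν` and `ν + 1`. -/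
def IsCylinderPair (ν : ℝ) (a b : ℝ → ℝ) : Prop :=
  ∀ x, 0 < x → HasDerivAt a (ν / x * a x - b x) x ∧ HasDerivAt b (a x - (ν + 1) / x * b x) x

namespace IsCylinderPair

variable {ν : ℝ} {a b : ℝ → ℝ}

theorem linearComb {a' b' : ℝ → ℝ} (h : IsCylinderPair ν a b) (h' : IsCylinderPair ν a' b')
    (c c' : ℝ) : IsCylinderPair ν (fun x => c * a x + c' * a' x) fun x => c * b x + c' * b' x := by
  intro x hx
  constructor
  · refine HasDerivAt.congr_deriv (((h x hx).1.const_mul c).add ((h' x hx).1.const_mul c')) ?_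
    ring
  · refine HasDerivAt.congr_deriv (((h x hx).2.const_mul c).add ((h' x hx).2.const_mul c')) ?_
    ring

/-- A Lyapunov argument. The derivative of `a² + b²` is `(2ν a² - 2(ν+1) b²) / x`; subtracting
`(2ν+1) ab/x` replaces both coefficients by their mean `-1`, up to an error `O(ab/x²)`. The
corrected energy thus decreases for large `x`, where it is comparable to `a² + b²`. -/
theorem exists_bound (h : IsCylinderPair ν a b) :
    ∃ M X : ℝ, 0 < X ∧ ∀ x, X ≤ x → a x ^ 2 + b x ^ 2 ≤ M := by
  set c : ℝ := 2 * ν + 1 with hc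
  set X : ℝ := |c| + 1 with hX
  have hX0 : 0 < X := by positivity
  have hd : ∀ x, 0 < x → HasDerivAt (fun x => a x ^ 2 + b x ^ 2 - c * (a x * b x) / x)
      (-(a x ^ 2 + b x ^ 2) / x + 2 * c * (a x * b x) / x ^ 2) x := by
    intro x hx
    obtain ⟨h1, h2⟩ := h x hx
    refine (((h1.pow 2).add (h2.pow 2)).sub
      (((h1.mul h2).const_mul c).div (hasDerivAt_id x) hx.ne')).congr_deriv ?_
    simp only [id, hc, Pi.mul_apply]
    field_simp
    ring
  have hab : ∀ x, X ≤ x → |c * (a x * b x) / x| ≤ (a x ^ 2 + b x ^ 2) / 2 := by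
    intro x hx
    have hx0 : 0 < x := hX0.trans_le hx
    have h1 : |a x * b x| ≤ (a x ^ 2 + b x ^ 2) / 2 := by
      rw [abs_mul, ← sq_abs (a x), ← sq_abs (b x)]
      nlinarith [sq_nonneg (|a x| - |b x|)]
    rw [abs_div, abs_mul, abs_of_pos hx0, div_le_iff₀ hx0, mul_comm]
    exact mul_le_mul h1 (by linarith) (abs_nonneg _) (by positivity)
  have hanti : AntitoneOn (fun x => a x ^ 2 + b x ^ 2 - c * (a x * b x) / x) (Set.Ici X) := by
    refine antitoneOn_of_deriv_nonpos (convex_Ici X)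
      (fun x hx => (hd x (hX0.trans_le hx)).continuousAt.continuousWithinAt) ?_ ?_
    · rw [interior_Ici]
      exact fun x hx => (hd x (hX0.trans hx)).differentiableAt.differentiableWithinAt
    · rw [interior_Ici]
      intro x hx
      have hx0 : 0 < x := hX0.trans hx
      rw [(hd x hx0).deriv]
      have e : -(a x ^ 2 + b x ^ 2) / x + 2 * c * (a x * b x) / x ^ 2 =
          (-(a x ^ 2 + b x ^ 2) + 2 * (c * (a x * b x) / x)) / x := by
        field_simp
      rw [e]
      have := (abs_le.1 (hab x (le_of_lt hx))).2
      exact div_nonpos_of_nonpos_of_nonneg (by linarith) hx0.le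
  -- By `hab` the corrected energy is at least `(a² + b²) / 2`, hence the factor `2`.
  refine ⟨2 * (a X ^ 2 + b X ^ 2 - c * (a X * b X) / X), X, hX0, fun x hx => ?_⟩
  have h1 := hanti Set.self_mem_Ici hx hx
  have h2 := (abs_le.1 (hab x hx)).2
  simp only at h1
  linarith

theorem tendsto_rpow_mul (h : IsCylinderPair ν a b) {p : ℝ} (hp : p < 0) {lam : ℝ}
    (hlam : 0 < lam) : Tendsto (fun x => x ^ p * a (lam * x)) atTop (𝓝 0) ∧
      Tendsto (fun x => x ^ p * b (lam * x)) atTop (𝓝 0) := by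
  obtain ⟨M, X, hX, hM⟩ := h.exists_bound
  have h0 : Tendsto (fun x : ℝ => x ^ p) atTop (𝓝 0) := by
    simpa using tendsto_rpow_neg_atTop (neg_pos.2 hp)
  have hev : ∀ᶠ x in atTop, X ≤ lam * x :=
    (tendsto_id.const_mul_atTop hlam).eventually_ge_atTop X
  constructor <;> refine h0.zero_mul_isBoundedUnder_le
    (isBoundedUnder_of_eventually_le (a := Real.sqrt M) ?_) <;>
    filter_upwards [hev] with x hx <;>
    refine Real.abs_le_sqrt ?_ <;>
    nlinarith [hM _ hx, sq_nonneg (a (lam * x)), sq_nonneg (b (lam * x))]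

theorem hasDerivAt_rpow_neg_mul (h : IsCylinderPair ν a b) {lam s : ℝ} (hlam : 0 < lam)
    (hs : 0 < s) : HasDerivAt (fun s => s ^ (-ν) * a (lam * s)) (-lam * (s ^ (-ν) * b (lam * s)))
      s := by
  have h1 := (h (lam * s) (mul_pos hlam hs)).1.comp s ((hasDerivAt_id s).const_mul lam)
  refine ((Real.hasDerivAt_rpow_const (p := -ν) (Or.inl hs.ne')).mul h1).congr_deriv ?_
  rw [Real.rpow_sub_one hs.ne']
  simp only [Function.comp]
  field_simp
  ring

theorem hasDerivAt_rpow_mul (h : IsCylinderPair ν a b) {lam s : ℝ} (hlam : 0 < lam)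
    (hs : 0 < s) : HasDerivAt (fun s => s ^ (ν + 1) * b (lam * s))
      (lam * (s ^ (ν + 1) * a (lam * s))) s := by
  have h1 := (h (lam * s) (mul_pos hlam hs)).2.comp s ((hasDerivAt_id s).const_mul lam)
  refine ((Real.hasDerivAt_rpow_const (p := ν + 1) (Or.inl hs.ne')).mul h1).congr_deriv ?_
  rw [Real.rpow_sub_one hs.ne']
  simp only [Function.comp]
  field_simp
  ring

end IsCylinderPair

/-! ### The transforms of the powers and membership in the kernel. -/

theorem hasWeberOrr_of_antideriv {k l r₀ lam : ℝ} (hr₀ : 0 < r₀) {f F φ : ℝ → ℝ}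
    (hF : ∀ s, 0 < s → HasDerivAt F (φ s) s)
    (hφ : ∀ s, 0 < s → ContinuousAt φ s)
    (he : ∀ s, 0 < s → weberOrrKernel k l r₀ lam s * f s * s = φ s)
    (h0 : F r₀ = 0) (hlim : Tendsto F atTop (𝓝 0)) : HasWeberOrr k l r₀ f lam 0 := by
  have hpos : ∀ R, r₀ ≤ R → ∀ s ∈ Set.uIcc r₀ R, 0 < s := by
    intro R hR s hs
    rw [Set.uIcc_of_le hR] at hs
    exact hr₀.trans_le hs.1
  have hint : ∀ R, r₀ ≤ R → IntervalIntegrable φ volume r₀ R := fun R hR =>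
    ContinuousOn.intervalIntegrable fun s hs => (hφ s (hpos R hR s hs)).continuousWithinAt
  have hcongr : ∀ R, r₀ ≤ R → Set.EqOn φ (fun s => weberOrrKernel k l r₀ lam s * f s * s)
      (Set.uIcc r₀ R) := fun R hR s hs => (he s (hpos R hR s hs)).symm
  refine ⟨fun R hR => (hint R hR).congr ((hcongr R hR).mono Set.uIoc_subset_uIcc),
    hlim.congr' ?_⟩
  filter_upwards [eventually_ge_atTop r₀] with R hR
  rw [← intervalIntegral.integral_congr (hcongr R hR),
    intervalIntegral.integral_eq_sub_of_hasDerivAt (fun s hs => hF s (hpos R hR s hs)) (hint R hR),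
    h0, sub_zero]

theorem hasWeberOrr_rpow_neg {k r₀ lam : ℝ} (hr₀ : 0 < r₀) (hk : 1 < k) (hlam : 0 < lam)
    (hJ : IsCylinderPair (k - 1) (besselJ (k - 1)) (besselJ k))
    (hY : IsCylinderPair (k - 1) (besselY (k - 1)) (besselY k)) :
    HasWeberOrr k (k - 1) r₀ (fun r => r ^ (-k)) lam 0 := by
  have hp := hJ.linearComb hY (besselY (k - 1) (lam * r₀)) (-besselJ (k - 1) (lam * r₀))
  set Z : ℝ := -lam * Real.sqrt (besselJ (k - 1) (lam * r₀) ^ 2 + besselY (k - 1) (lam * r₀) ^ 2)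
    with hZ
  refine hasWeberOrr_of_antideriv hr₀
    (fun s hs => (hp.hasDerivAt_rpow_neg_mul hlam hs).div_const Z) (fun s hs => ?_)
    (fun s hs => ?_) ?_ ?_
  · have hc := (hp (lam * s) (mul_pos hlam hs)).2.continuousAt.comp
      (f := fun s => lam * s) (continuous_const_mul lam).continuousAt
    exact (continuousAt_const.mul
      ((Real.continuousAt_rpow_const s _ (Or.inl hs.ne')).mul hc)).div_const Z
  -- Only `-lam` is cancelled; the square root stays as a common denominator, so it need not be
  -- shown nonzero.
  · rw [hZ, mul_div_mul_left _ _ (neg_ne_zero.2 hlam.ne'), weberOrrKernel,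
      show -(k - 1) = -k + 1 by ring, Real.rpow_add_one hs.ne']
    ring
  · rw [show besselY (k - 1) (lam * r₀) * besselJ (k - 1) (lam * r₀) +
      -besselJ (k - 1) (lam * r₀) * besselY (k - 1) (lam * r₀) = 0 by ring]
    simp
  · simpa using (hp.tendsto_rpow_mul (p := -(k - 1)) (by linarith) hlam).1.div_const Z

theorem hasWeberOrr_rpow {k r₀ lam : ℝ} (hr₀ : 0 < r₀) (hk : k < -1) (hlam : 0 < lam)
    (hJ : IsCylinderPair k (besselJ k) (besselJ (k + 1)))
    (hY : IsCylinderPair k (besselY k) (besselY (k + 1))) :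
    HasWeberOrr k (k + 1) r₀ (fun r => r ^ k) lam 0 := by
  have hp := hJ.linearComb hY (besselY (k + 1) (lam * r₀)) (-besselJ (k + 1) (lam * r₀))
  set Z : ℝ := lam * Real.sqrt (besselJ (k + 1) (lam * r₀) ^ 2 + besselY (k + 1) (lam * r₀) ^ 2)
    with hZ
  refine hasWeberOrr_of_antideriv hr₀
    (fun s hs => (hp.hasDerivAt_rpow_mul hlam hs).div_const Z) (fun s hs => ?_)
    (fun s hs => ?_) ?_ ?_
  · have hc := (hp (lam * s) (mul_pos hlam hs)).1.continuousAt.comp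
      (f := fun s => lam * s) (continuous_const_mul lam).continuousAt
    exact (continuousAt_const.mul
      ((Real.continuousAt_rpow_const s _ (Or.inl hs.ne')).mul hc)).div_const Z
  · rw [hZ, mul_div_mul_left _ _ hlam.ne', weberOrrKernel, Real.rpow_add_one hs.ne']
    ring
  · rw [show besselY (k + 1) (lam * r₀) * besselJ (k + 1) (lam * r₀) +
      -besselJ (k + 1) (lam * r₀) * besselY (k + 1) (lam * r₀) = 0 by ring]
    simp
  · simpa using (hp.tendsto_rpow_mul (p := k + 1) (by linarith) hlam).2.div_const Z

theorem memLp_rpow_radialMeasure {p r₀ : ℝ} (hr₀ : 0 < r₀) (hp : p < -1) :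
    MemLp (fun r : ℝ => r ^ p) 2 (radialMeasure r₀) := by
  have hm : AEStronglyMeasurable (fun r : ℝ => r ^ p) (radialMeasure r₀) :=
    (measurable_id.pow_const p).aestronglyMeasurable
  rw [memLp_two_iff_integrable_sq hm, radialMeasure,
    integrable_withDensity_iff ENNReal.measurable_ofReal
      (ae_of_all _ fun _ => ENNReal.ofReal_lt_top)]
  -- The square of `r^p` times the weight `r` is `r^(2p+1)`, and `2p + 1 < -1`.
  refine (integrableOn_Ioi_rpow_of_lt (a := 2 * p + 1) (by linarith) hr₀).congr_fun ?_
    measurableSet_Ioi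
  intro r hr
  have h0 : (0 : ℝ) < r := hr₀.trans hr
  simp only
  rw [ENNReal.toReal_ofReal h0.le, Real.rpow_add_one h0.ne', two_mul, Real.rpow_add h0, sq]

theorem weberOrrKer_rpow {p k l r₀ : ℝ} (hr₀ : 0 < r₀) (hp : p < -1)
    (h : ∀ lam, 0 < lam → HasWeberOrr k l r₀ (fun r => r ^ p) lam 0) :
    (∃ h : MemLp (fun r : ℝ => r ^ p) 2 (radialMeasure r₀),
      h.toLp (fun r : ℝ => r ^ p) ∈ weberOrrKer k l r₀ hr₀) ∧ weberOrrKer k l r₀ hr₀ ≠ ⊥ := by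
  have hL := memLp_rpow_radialMeasure hr₀ hp
  have hmem : hL.toLp (fun r : ℝ => r ^ p) ∈ weberOrrKer k l r₀ hr₀ := fun lam hlam =>
    (h lam hlam).congr_ae hr₀ hL.coeFn_toLp.symm
  refine ⟨⟨hL, hmem⟩, fun hbot => ?_⟩
  rw [hbot, Submodule.mem_bot] at hmem
  have h0 : ∀ᵐ s ∂(radialMeasure r₀), s ^ p = 0 := by
    have := hL.coeFn_toLp.symm
    rw [hmem] at this
    exact this.trans (Lp.coeFn_zero ℝ 2 _)
  -- `s^p` is positive everywhere on `(r₀, ∞)`, a set of positive measure, so its class is not zero.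
  have h1 : ∀ᵐ s ∂(volume.restrict (Set.Ioi r₀)), False := by
    filter_upwards [ae_restrict_of_ae_radialMeasure hr₀ h0, ae_restrict_mem measurableSet_Ioi]
      with s hs hs'
    exact (Real.rpow_pos_of_pos (hr₀.trans hs') p).ne' hs
  rw [eventually_false_iff_eq_bot, ae_eq_bot, Measure.restrict_eq_zero] at h1
  simp at h1

theorem isCylinderPair_of_recurrence {ν : ℝ} {C : ℝ → ℝ → ℝ}
    (hd : ∀ μ x, 0 < x → HasDerivAt (C μ) (μ / x * C μ x - C (μ + 1) x) x)
    (hr : ∀ x, 0 < x → C ν x = 2 * (ν + 1) / x * C (ν + 1) x - C (ν + 2) x) :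
    IsCylinderPair ν (C ν) (C (ν + 1)) := by
  refine fun x hx => ⟨hd ν x hx, (hd (ν + 1) x hx).congr_deriv ?_⟩
  rw [hr x hx, show ν + 1 + 1 = ν + 2 by ring]
  ring

theorem isCylinderPair_besselJ (ν : ℝ) : IsCylinderPair ν (besselJ ν) (besselJ (ν + 1)) :=
  isCylinderPair_of_recurrence (fun μ _ hx => hasDerivAt_besselJ μ hx) fun x hx => by
    have h := besselJ_recurrence (ν + 1) hx
    rwa [show ν + 1 - 1 = ν by ring, show ν + 1 + 1 = ν + 2 by ring] at h

theorem isCylinderPair_besselY (ν : ℝ) : IsCylinderPair ν (besselY ν) (besselY (ν + 1)) :=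
  isCylinderPair_of_recurrence (fun μ _ hx => hasDerivAt_besselY μ hx) fun _ hx =>
    besselY_recurrence ν hx

theorem mainTheorem6 (r₀ : ℝ) (hr₀ : 0 < r₀) :
    (∀ k : ℝ, 1 < k →
      (∃ h : MemLp (fun r : ℝ => r ^ (-k)) 2 (radialMeasure r₀),
        h.toLp (fun r : ℝ => r ^ (-k)) ∈ weberOrrKer k (k - 1) r₀ hr₀) ∧
      weberOrrKer k (k - 1) r₀ hr₀ ≠ ⊥) ∧
    (∀ k : ℝ, k < -1 →
      (∃ h : MemLp (fun r : ℝ => r ^ k) 2 (radialMeasure r₀),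
        h.toLp (fun r : ℝ => r ^ k) ∈ weberOrrKer k (k + 1) r₀ hr₀) ∧
      weberOrrKer k (k + 1) r₀ hr₀ ≠ ⊥) := by
  refine ⟨fun k hk => ?_, fun k hk => ?_⟩
  · refine weberOrrKer_rpow hr₀ (by linarith) fun lam hlam => hasWeberOrr_rpow_neg hr₀ hk hlam ?_ ?_
    · simpa using isCylinderPair_besselJ (k - 1)
    · simpa using isCylinderPair_besselY (k - 1)
  · exact weberOrrKer_rpow hr₀ hk fun lam hlam => hasWeberOrr_rpow hr₀ hk hlam
      (isCylinderPair_besselJ k) (isCylinderPair_besselY k)
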